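/- Conventions. An $\mathbb{R}$-tree is a metric space $T$ in which any two points are joined by a unique geodesic segment and in which the union of two geodesic segments meeting exactly in a common endpoint is again a geodesic segment. For an isometry $\gamma$ of $T$ (onto $T$), its translation length is $l(\gamma)=\inf_{x\in T}d(x,\gamma x)$; $\gamma$ is hyperbolic if $l(\gamma)>0$, and then its translation axis is $A_\gamma=\{x\in T: d(x,\gamma x)=l(\gamma)\}$, oriented by the direction in which $\gamma$ translates it. Proposition A.1. Let $\gamma,\delta$ be two hyperbolic isometries of an $\mathbb{R}$-tree $T$. (1) Assume that $A_\gamma\cap A_\delta=\emptyset$. There is a connecting arc between $A_\gamma$ and $A_\delta$, that is, a geodesic segment $S=[p,q]$ with $S\cap A_\gamma=\{p\}$ and $S\cap A_\delta=\{q\}$. For any such $S$, with length $D=d(p,q)$, the isometry $\gamma\delta$ is hyperbolic, $S$ is contained in the translation axis of $\gamma\delta$, the isometry $\gamma\delta$ translates $q$ towards $p$, and $$l(\gamma\delta)=l(\gamma)+l(\delta)+2D.$$ (2) Assume that $A_\gamma\cap A_\delta\neq\emptyset$. Let $D\in[0,+\infty]$ be the length (that is, the diameter) of the segment $A_\gamma\cap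 A_\delta$, so that $D=0$ if this intersection is reduced to a point, and $D=+\infty$ if it is noncompact. (i) If $D=0$, or if $D>0$ and the translation directions of $\gamma$ and $\delta$ on $A_\gamma\cap A_\delta$ coincide, then $$l(\gamma\delta)=l(\gamma)+l(\delta).$$ (ii) Assume that $D>0$ and that the translation directions of $\gamma$ and $\delta$ on $A_\gamma\cap A_\delta$ are opposite. If $l(\gamma)<l(\delta)$, let $D'\in[0,+\infty]$ be the length of the (possibly empty or infinite) segment $A_\delta\cap\gamma A_\delta$; if $l(\delta)<l(\gamma)$, let $D'\in[0,+\infty]$ be the length of $A_\gamma\cap\delta A_\gamma$ (the length of the empty set being $0$; $D'$ plays no role if $l(\gamma)=l(\delta)$). Then - $l(\gamma\delta)=l(\gamma)+l(\delta)-2D$ if $D<\min\{l(\gamma),l(\delta)\}$; - $l(\gamma\delta)=|l(\gamma)-l(\delta)|$ if $\min\{l(\gamma),l(\delta)\}<D<\max\{l(\gamma),l(\delta)\}$ or $\max\{l(\gamma),l(\delta)\}\le D$; - $l(\gamma\delta)=0$ if $\min\{l(\gamma),l(\delta)\}=D<\max\{l(\gamma),l(\delta)\}\le D+2D'$; - $l(\gamma\delta)=\max\{l(\gamma),l(\delta)\}-D-2D'$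 if $\min\{l(\gamma),l(\delta)\}=D$ and $\max\{l(\gamma),l(\delta)\}>D+2D'$. In all four cases, $l(\gamma\delta)<l(\gamma)+l(\delta)$. -/

import Mathlib

namespace RTree

open scoped ENNReal

section Trees

variable {T : Type*} [MetricSpace T]

/-- `S` is a geodesic segment from `x` to `y`: the image of an isometric embedding of the
interval `[0, d(x, y)]` sending `0` to `x` and `d(x, y)` to `y`. -/
def IsGeodesicSegment (S : Set T) (x y : T) : Prop :=
  ∃ c : ℝ → T, c 0 = x ∧ c (dist x y) = y ∧
    (∀ s ∈ Set.Icc (0 : ℝ) (dist x y), ∀ t ∈ Set.Icc (0 : ℝ) (dist x y),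
      dist (c s) (c t) = |s - t|) ∧
    S = c '' Set.Icc (0 : ℝ) (dist x y)

/-- `S` is an arc from `p` to `q` connecting the subset `A` to the subset `B`: a geodesic segment
which meets `A` exactly in `p` and `B` exactly in `q`. -/
def IsConnectingArc (S A B : Set T) (p q : T) : Prop :=
  IsGeodesicSegment S p q ∧ S ∩ A = {p} ∧ S ∩ B = {q}

/-- The length in `[0, ∞]` of a (possibly empty, reduced to a point, or unbounded) segment,
that is, the supremum of the distances between two of its points. -/
noncomputable def segmentLength (S : Set T) : ℝ≥0∞ := Metric.ediam S

/-- The translation length `l(g) = inf_x d(x, g x)`. -/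
noncomputable def translationLength (g : T ≃ᵢ T) : ℝ := ⨅ x : T, dist x (g x)

/-- An isometry is hyperbolic if its translation length is positive. -/
def IsHyperbolic (g : T ≃ᵢ T) : Prop := 0 < translationLength g

/-- The translation axis of a hyperbolic isometry. -/
def axis (g : T ≃ᵢ T) : Set T := {x | dist x (g x) = translationLength g}

/-- `g` translates `x` towards `y`: the point `y` lies between `x` and some iterate `gⁿ x`, `n ≥ 0`.
For points of the axis of a hyperbolic `g`, this is the linear order on the axis given by its
translation direction (`x` comes before or is equal to `y`). -/
def TranslatesTowards (g : T ≃ᵢ T) (x y : T) : Prop :=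
  ∃ n : ℕ, dist x y + dist y ((g ^ n) x) = dist x ((g ^ n) x)

/-- The translation directions of `g` and `h` on `I` (a common segment of their axes) coincide. -/
def SameDirectionOn (g h : T ≃ᵢ T) (I : Set T) : Prop :=
  ∀ x ∈ I, ∀ y ∈ I, (TranslatesTowards g x y ↔ TranslatesTowards h x y)

/-- The translation directions of `g` and `h` on `I` (a common segment of their axes) are
opposite. -/
def OppositeDirectionOn (g h : T ≃ᵢ T) (I : Set T) : Prop :=
  ∀ x ∈ I, ∀ y ∈ I, (TranslatesTowards g x y ↔ TranslatesTowards h y x)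

end Trees

/-- A metric space is an `ℝ`-tree if any two points are joined by a unique geodesic segment, and
two geodesic segments which meet exactly in a common endpoint have a geodesic segment as union. -/
structure IsRTree (T : Type*) [MetricSpace T] : Prop where
  existsUnique_segment : ∀ x y : T, ∃! S : Set T, IsGeodesicSegment S x y
  union_segment : ∀ (x y z : T) (S₁ S₂ : Set T), IsGeodesicSegment S₁ x y →
    IsGeodesicSegment S₂ y z → S₁ ∩ S₂ = {y} → IsGeodesicSegment (S₁ ∪ S₂) x z

end RTree

namespace RTree

/-! If `x`, `g x`, `g (g x)` are distinct and lie in this order on a geodesic, consecutive pieces of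
the orbit overlap in nontrivial segments. In a tree such pieces concatenate (`btw_concat`), so the
forward orbit is aligned and `l(g) = dist x (g x)` (`translationLength_of_btw`). Apart from the
vanishing cases, which use a fixed point or `l(γ) = l(δ)`, each formula comes from a base point
aligned with its images under `γ * δ`.

For disjoint axes, axes crossing in a point, equal directions, and a short opposite overlap,
alignment is checked factor by factor in `translationLength_mul_of_btw`, from two points `u`, `v`:
the ends of the connecting arc, one common point taken twice, or the ends of the overlap.

For opposite directions with `l(γ) < l(δ)`, an overlap longer than `l(γ)` makes `γ` undo part of the
translation by `δ`, leaving the difference. If the overlap has length exactly `l(γ)`, `γ` may also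
fold the axis of `δ` back onto itself beyond the overlap. The fold has length `D'` and shortens the
displacement by `2D'`; if it is long enough, its point at distance `(l(δ) - l(γ)) / 2` from the
overlap is fixed. The opposite order of lengths follows by conjugation. -/

/-- The point `y` lies between `x` and `z`. -/
def Btw {T : Type*} [MetricSpace T] (x y z : T) : Prop := dist x y + dist y z = dist x z

/-! ### Betweenness in metric spaces. -/

section Between

variable {T : Type*} [MetricSpace T]

theorem Btw.symm {x y z : T} (h : Btw x y z) : Btw z y x := by
  unfold Btw at *
  rw [dist_comm z y, dist_comm y x, dist_comm z x]
  linarith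

theorem btw_self_left (x y : T) : Btw x x y := by simp [Btw]

theorem btw_self_right (x y : T) : Btw x y y := by simp [Btw]

/-- If `y` is between `x` and `z` and `w` is between `x` and `y`, then the four points are in
the order `x, w, y, z`. -/
theorem Btw.trans_left {x w y z : T} (h : Btw x y z) (h' : Btw x w y) :
    Btw x w z ∧ Btw w y z := by
  unfold Btw at *
  have h1 := dist_triangle x w z
  have h2 := dist_triangle w y z
  constructor <;> linarith

theorem Btw.trans_right {x y w z : T} (h : Btw x y z) (h' : Btw y w z) :
    Btw x w z ∧ Btw x y w := by
  have := h.symm.trans_left h'.symm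
  exact ⟨this.1.symm, this.2.symm⟩

theorem btw_map_iff (g : T ≃ᵢ T) {x y z : T} : Btw (g x) (g y) (g z) ↔ Btw x y z := by
  simp only [Btw, g.isometry.dist_eq]

theorem Btw.map {x y z : T} (h : Btw x y z) (g : T ≃ᵢ T) : Btw (g x) (g y) (g z) :=
  (btw_map_iff g).2 h

theorem btw_of_isometry {f : ℝ → T} (hf : Isometry f) {r s t : ℝ} (h₁ : r ≤ s) (h₂ : s ≤ t) :
    Btw (f r) (f s) (f t) := by
  unfold Btw
  rw [hf.dist_eq, hf.dist_eq, hf.dist_eq, Real.dist_eq, Real.dist_eq, Real.dist_eq,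
    abs_of_nonpos (by linarith), abs_of_nonpos (by linarith), abs_of_nonpos (by linarith)]
  ring

theorem btw_of_isometry_anti {f : ℝ → T} (hf : Isometry f) {r s t : ℝ} (h₁ : t ≤ s) (h₂ : s ≤ r) :
    Btw (f r) (f s) (f t) := (btw_of_isometry hf h₁ h₂).symm

end Between

/-! ### Segments, medians and the four-point inequality in an `ℝ`-tree. -/

section Geodesic

variable {T : Type*} [MetricSpace T]

theorem IsGeodesicSegment.btw {S : Set T} {x y z : T} (hS : IsGeodesicSegment S x y)
    (hz : z ∈ S) : Btw x z y := by
  obtain ⟨c, h0, h1, hc, rfl⟩ := hS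
  obtain ⟨t, ht, rfl⟩ := hz
  have h2 := hc 0 ⟨le_rfl, dist_nonneg⟩ t ht
  have h3 := hc t ht _ ⟨dist_nonneg, le_rfl⟩
  rw [h0, abs_of_nonpos (by linarith [ht.1])] at h2
  rw [h1, abs_of_nonpos (by linarith [ht.2])] at h3
  unfold Btw
  linarith

theorem IsGeodesicSegment.isCompact {S : Set T} {x y : T} (hS : IsGeodesicSegment S x y) :
    IsCompact S := by
  obtain ⟨c, -, -, hc, rfl⟩ := hS
  refine isCompact_Icc.image_of_continuousOn ?_
  have : LipschitzOnWith 1 c (Set.Icc 0 (dist x y)) :=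
    LipschitzOnWith.of_dist_le_mul fun s hs t ht => by
      rw [hc s hs t ht, Real.dist_eq]
      simp
  exact this.continuousOn

variable (hT : IsRTree T)
include hT

theorem IsRTree.exists_segment (x y : T) : ∃ S : Set T, IsGeodesicSegment S x y :=
  (hT.existsUnique_segment x y).exists

/-- Metric betweenness suffices: segments `[x, z]` and `[z, y]` meet only in `z`, so their union is
a segment, equal to `S` by uniqueness. -/
theorem IsRTree.mem_segment_iff {S : Set T} {x y z : T} (hS : IsGeodesicSegment S x y) :
    z ∈ S ↔ Btw x z y := by
  refine ⟨hS.btw, fun h => ?_⟩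
  obtain ⟨S₁, h₁⟩ := hT.exists_segment x z
  obtain ⟨S₂, h₂⟩ := hT.exists_segment z y
  have hz₁ : z ∈ S₁ := by
    obtain ⟨c, -, h1, -, rfl⟩ := h₁
    exact ⟨_, ⟨dist_nonneg, le_rfl⟩, h1⟩
  have hz₂ : z ∈ S₂ := by
    obtain ⟨c, h0, -, -, rfl⟩ := h₂
    exact ⟨_, ⟨le_rfl, dist_nonneg⟩, h0⟩
  have hinter : S₁ ∩ S₂ = {z} := by
    refine Set.Subset.antisymm (fun w hw => ?_) (by simp [hz₁, hz₂])
    have hw₁ := h₁.btw hw.1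
    have hw₂ := h₂.btw hw.2
    unfold Btw at *
    have := dist_triangle x w y
    rw [dist_comm z w] at hw₂
    have := dist_nonneg (x := w) (y := z)
    exact dist_le_zero.1 (by linarith)
  have := (hT.existsUnique_segment x y).unique hS (hT.union_segment _ _ _ _ _ h₁ h₂ hinter)
  rw [this]
  exact Or.inl hz₁

/-- Distances between two points of a segment. -/
theorem IsRTree.dist_eq_of_btw {x y u v : T} (hu : Btw x u y) (hv : Btw x v y) :
    dist u v = |dist x u - dist x v| := by
  obtain ⟨S, hS⟩ := hT.exists_segment x y
  have hu' := (hT.mem_segment_iff hS).2 hu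
  have hv' := (hT.mem_segment_iff hS).2 hv
  obtain ⟨c, h0, h1, hc, rfl⟩ := hS
  obtain ⟨s, hs, rfl⟩ := hu'
  obtain ⟨t, ht, rfl⟩ := hv'
  have h0' : (0 : ℝ) ∈ Set.Icc 0 (dist x y) := ⟨le_rfl, dist_nonneg⟩
  have h2 := hc 0 h0' s hs
  have h3 := hc 0 h0' t ht
  rw [h0, abs_of_nonpos (by linarith [hs.1])] at h2
  rw [h0, abs_of_nonpos (by linarith [ht.1])] at h3
  rw [hc s hs t ht, h2, h3]
  congr 1
  ring

theorem IsRTree.eq_of_btw {x y u v : T} (hu : Btw x u y) (hv : Btw x v y)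
    (h : dist x u = dist x v) : u = v := by
  rw [← dist_eq_zero, hT.dist_eq_of_btw hu hv, h, sub_self, abs_zero]

theorem IsRTree.btw_of_dist_le {x y u v : T} (hu : Btw x u y) (hv : Btw x v y)
    (h : dist x u ≤ dist x v) : Btw x u v := by
  have := hT.dist_eq_of_btw hu hv
  rw [abs_of_nonpos (by linarith)] at this
  unfold Btw
  linarith

theorem IsRTree.exists_btw (x y : T) {t : ℝ} (h₀ : 0 ≤ t) (h₁ : t ≤ dist x y) :
    ∃ z, Btw x z y ∧ dist x z = t := by
  obtain ⟨S, hS⟩ := hT.exists_segment x y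
  have hS' := hS
  obtain ⟨c, h0, h1, hc, rfl⟩ := hS
  have hct := hc 0 ⟨le_rfl, dist_nonneg⟩ t ⟨h₀, h₁⟩
  refine ⟨c t, hS'.btw ⟨t, ⟨h₀, h₁⟩, rfl⟩, ?_⟩
  rw [h0, abs_of_nonpos (by linarith)] at hct
  linarith

/-- Every triple of points has a median. -/
theorem IsRTree.exists_median (x y z : T) : ∃ m, Btw x m y ∧ Btw x m z ∧ Btw y m z := by
  obtain ⟨S₁, hS₁⟩ := hT.exists_segment x y
  obtain ⟨S₂, hS₂⟩ := hT.exists_segment x z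
  have hx : x ∈ S₁ ∩ S₂ :=
    ⟨(hT.mem_segment_iff hS₁).2 (btw_self_left _ _), (hT.mem_segment_iff hS₂).2 (btw_self_left _ _)⟩
  -- The median is the point where `[x, y]` and `[x, z]` part. Maximality of `dist x m` makes `[y,
  -- m]` and `[m, z]` meet only in `m`.
  obtain ⟨m, hm, hmax⟩ := (hS₁.isCompact.inter hS₂.isCompact).exists_isMaxOn ⟨x, hx⟩
    (f := fun w => dist x w) (by fun_prop)
  have hm₁ := hS₁.btw hm.1
  have hm₂ := hS₂.btw hm.2
  refine ⟨m, hm₁, hm₂, ?_⟩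
  obtain ⟨S₃, hS₃⟩ := hT.exists_segment y m
  obtain ⟨S₄, hS₄⟩ := hT.exists_segment m z
  have hinter : S₃ ∩ S₄ = {m} := by
    refine Set.Subset.antisymm (fun w hw => ?_) ?_
    · have h3 := (hS₃.btw hw.1).symm
      have h4 := hS₄.btw hw.2
      have h5 := hm₁.trans_right h3
      have h6 := hm₂.trans_right h4
      have h7 : dist x w ≤ dist x m :=
        hmax ⟨(hT.mem_segment_iff hS₁).2 h5.1, (hT.mem_segment_iff hS₂).2 h6.1⟩
      have h8 := h5.2
      unfold Btw at h8
      have : dist m w ≤ 0 := by linarith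
      exact (dist_le_zero.1 this).symm
    · rintro w rfl
      exact ⟨(hT.mem_segment_iff hS₃).2 (btw_self_right _ _),
        (hT.mem_segment_iff hS₄).2 (btw_self_left _ _)⟩
  have hU := hT.union_segment _ _ _ _ _ hS₃ hS₄ hinter
  exact hU.btw (Or.inl ((hT.mem_segment_iff hS₃).2 (btw_self_right _ _)))

/-- The four-point inequality. -/
theorem IsRTree.four_point (x y z w : T) :
    dist x y + dist z w ≤ max (dist x z + dist y w) (dist x w + dist y z) := by
  obtain ⟨m, hm₁, hm₂, hm₃⟩ := hT.exists_median x y z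
  obtain ⟨n, hn₁, hn₂, hn₃⟩ := hT.exists_median x y w
  have h := hT.dist_eq_of_btw hm₁ hn₁
  have h1 := dist_triangle4 z m n w
  have h2 := dist_comm z m
  have h3 := dist_comm m y
  have h4 := dist_comm n y
  unfold Btw at *
  -- Both medians lie on `[x, y]`; their order there selects the alternative.
  rcases le_total (dist x m) (dist x n) with hmn | hmn
  · rw [abs_of_nonpos (by linarith)] at h
    exact le_max_of_le_right (by linarith)
  · rw [abs_of_nonneg (by linarith)] at h
    exact le_max_of_le_left (by linarith)

/-- Concatenating two segments which overlap in a nontrivial segment. -/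
theorem IsRTree.btw_concat {x y z w : T} (h₁ : Btw x y z) (h₂ : Btw y z w) (hne : y ≠ z) :
    Btw x y w ∧ Btw x z w := by
  have h := hT.four_point x z y w
  have hpos := dist_pos.2 hne
  have h3 := dist_triangle x y w
  have h4 := dist_triangle x z w
  have h5 := dist_comm z y
  unfold Btw at *
  -- The first alternative would force `dist y z ≤ 0`.
  rcases le_max_iff.1 h with h | h
  · linarith
  · constructor <;> linarith

end Geodesic

/-! ### Translation lengths and axes. -/

section TranslationLength

variable {T : Type*} [MetricSpace T]

theorem translationLength_nonneg (g : T ≃ᵢ T) : 0 ≤ translationLength g :=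
  Real.iInf_nonneg fun _ => dist_nonneg

theorem translationLength_le (g : T ≃ᵢ T) (x : T) : translationLength g ≤ dist x (g x) :=
  ciInf_le ⟨0, by rintro _ ⟨y, rfl⟩; exact dist_nonneg⟩ x

theorem translationLength_eq_zero_of_fixed {g : T ≃ᵢ T} {x : T} (h : g x = x) :
    translationLength g = 0 :=
  le_antisymm (by simpa [h] using translationLength_le g x) (translationLength_nonneg g)

/-- The two products are conjugate by `h`. This exchanges the roles of `γ` and `δ` in the asymmetric
cases. -/
theorem translationLength_mul_comm (g h : T ≃ᵢ T) :
    translationLength (g * h) = translationLength (h * g) := by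
  unfold translationLength
  refine Equiv.iInf_congr h.toEquiv fun x => ?_
  exact h.isometry.dist_eq _ _

theorem pow_succ_apply (g : T ≃ᵢ T) (n : ℕ) (x : T) : (g ^ (n + 1)) x = g ((g ^ n) x) := by
  rw [pow_succ']; rfl

theorem pow_succ_apply' (g : T ≃ᵢ T) (n : ℕ) (x : T) : (g ^ (n + 1)) x = (g ^ n) (g x) := by
  rw [pow_succ]; rfl

theorem mem_axis_of_btw {g : T ≃ᵢ T} {x y : T} (hx : x ∈ axis g) (h : Btw x y (g x)) :
    y ∈ axis g := by
  refine le_antisymm ?_ (translationLength_le g y)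
  have h1 : dist x (g x) = translationLength g := hx
  have h2 := dist_triangle y (g x) (g y)
  rw [g.isometry.dist_eq] at h2
  unfold Btw at h
  linarith

theorem map_mem_axis {g : T ≃ᵢ T} {x : T} (hx : x ∈ axis g) : g x ∈ axis g := by
  have : dist x (g x) = translationLength g := hx
  rwa [← g.isometry.dist_eq] at this

theorem map_mem_axis_iff {g : T ≃ᵢ T} {x : T} : g x ∈ axis g ↔ x ∈ axis g := by
  simp only [axis, Set.mem_ofPred_eq, g.isometry.dist_eq]

theorem isClosed_axis (g : T ≃ᵢ T) : IsClosed (axis g) :=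
  isClosed_eq (continuous_id.dist g.continuous) continuous_const

variable (hT : IsRTree T)
include hT

theorem IsRTree.dist_pow_of_btw {g : T ≃ᵢ T} {x : T} (h : Btw x (g x) (g (g x))) (n : ℕ) :
    dist x ((g ^ n) x) = n * dist x (g x) := by
  rcases eq_or_ne x (g x) with hx | hx
  · have : ∀ n : ℕ, (g ^ n) x = x := by
      intro n
      induction n with
      | zero => rfl
      | succ n ih => rw [pow_succ_apply, ih, ← hx]
    rw [this, ← hx]
    simp
  · have key : ∀ n : ℕ, dist x ((g ^ n) x) = n * dist x (g x) ∧
        Btw x ((g ^ n) x) ((g ^ (n + 1)) x) := by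
      intro n
      induction n with
      | zero => simp [Btw]
      | succ n ih =>
        obtain ⟨ih1, ih2⟩ := ih
        have h1 : Btw ((g ^ n) x) ((g ^ (n + 1)) x) ((g ^ (n + 2)) x) := by
          have := h.map (g ^ n)
          rwa [← pow_succ_apply', ← pow_succ_apply', ← pow_succ_apply'] at this
        have h2 : dist ((g ^ n) x) ((g ^ (n + 1)) x) = dist x (g x) := by
          rw [pow_succ_apply', (g ^ n).isometry.dist_eq]
        refine ⟨?_, (hT.btw_concat ih2 h1 ?_).2⟩
        · unfold Btw at ih2
          rw [← ih2, ih1, h2]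
          push_cast
          ring
        · rw [← dist_pos, h2]
          exact dist_pos.2 hx
    exact (key n).1

/-- Displacements under `g ^ n` at `x` and `y` differ by at most `2 * dist x y`. The one at `x`
equals `n * dist x (g x)`, the one at `y` is at most `n * dist y (g y)`; large `n` compares the
slopes. -/
theorem IsRTree.translationLength_of_btw {g : T ≃ᵢ T} {x : T} (h : Btw x (g x) (g (g x))) :
    translationLength g = dist x (g x) := by
  refine le_antisymm (translationLength_le g x) ?_
  have : Nonempty T := ⟨x⟩
  refine le_ciInf fun y => ?_
  have hy : ∀ n : ℕ, dist y ((g ^ n) y) ≤ n * dist y (g y) := by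
    intro n
    induction n with
    | zero => simp
    | succ n ih =>
      have h1 := dist_triangle y ((g ^ n) y) ((g ^ (n + 1)) y)
      rw [pow_succ_apply' g n y, (g ^ n).isometry.dist_eq] at h1
      rw [pow_succ_apply']
      push_cast
      linarith
  by_contra! hlt
  obtain ⟨n, hn⟩ := exists_nat_gt (2 * dist x y / (dist x (g x) - dist y (g y)))
  rw [div_lt_iff₀ (by linarith)] at hn
  have h1 := hT.dist_pow_of_btw h n
  have h2 := hy n
  have h3 := dist_triangle4 x y ((g ^ n) y) ((g ^ n) x)
  rw [(g ^ n).isometry.dist_eq, dist_comm y x] at h3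
  linarith

theorem IsRTree.mem_axis_of_btw {g : T ≃ᵢ T} {x : T} (h : Btw x (g x) (g (g x))) : x ∈ axis g :=
  (hT.translationLength_of_btw h).symm

/-- The median `w` of `x`, `g x`, `g (g x)` measures the backtracking at `g x`. If it reaches half
of `dist x (g x)`, the midpoint of `[x, g x]` is fixed, which hyperbolicity excludes; otherwise the
preimage of `w` is on the axis. -/
theorem IsRTree.exists_mem_axis {g : T ≃ᵢ T} (hg : IsHyperbolic g) : (axis g).Nonempty := by
  have hne : Nonempty T := by
    by_contra hne
    rw [not_nonempty_iff] at hne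
    simp [IsHyperbolic, translationLength, Real.iInf_of_isEmpty] at hg
  obtain ⟨x⟩ := hne
  obtain ⟨w, hw₁, hw₃, hw₂⟩ := hT.exists_median x (g x) (g (g x))
  have hwm := hw₁
  have hww := hw₂
  have ha : dist (g x) (g (g x)) = dist x (g x) := g.isometry.dist_eq _ _
  unfold Btw at hwm hww
  rw [ha] at hww
  rcases le_or_gt (dist x (g x) / 2) (dist (g x) w) with he | he
  · obtain ⟨m, hm, hmd⟩ := hT.exists_btw x (g x) (t := dist x (g x) / 2)
      (by positivity) (by linarith [dist_nonneg (x := x) (y := g x)])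
    exfalso
    have hgm := hm.map g
    have hmm := hm
    unfold Btw at hmm
    have hgmd : dist (g x) (g m) = dist x (g x) / 2 := by rw [g.isometry.dist_eq, hmd]
    have h1 : Btw (g x) m w :=
      hT.btw_of_dist_le hm.symm hw₁.symm (by rw [dist_comm (g x) m]; linarith)
    have h2 : Btw (g x) (g m) w := hT.btw_of_dist_le hgm hw₂ (by linarith)
    have h3 : m = g m := hT.eq_of_btw h1 h2 (by rw [dist_comm (g x) m]; linarith)
    exact absurd hg (by simp [IsHyperbolic, translationLength_eq_zero_of_fixed h3.symm])
  · obtain ⟨u, rfl⟩ := g.surjective w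
    have hu : dist x u = dist (g x) (g u) := (g.isometry.dist_eq _ _).symm
    have hux : Btw x u (g x) := (btw_map_iff g).1 hw₂
    have h1 : Btw x u (g u) := hT.btw_of_dist_le hux hw₁ (by
      rw [dist_comm (g u)] at hwm
      linarith)
    have h2 : Btw u (g u) (g x) := (hw₁.trans_left h1).2
    have h3 : Btw x (g u) (g (g u)) := (hw₃.trans_right (h2.map g)).2
    exact ⟨u, hT.mem_axis_of_btw (h3.trans_left h1).2⟩

/-- Points of the axis of a hyperbolic isometry are translated along geodesics. -/
theorem IsRTree.btw_of_mem_axis {g : T ≃ᵢ T} (hg : IsHyperbolic g) {x : T} (hx : x ∈ axis g) :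
    Btw x (g x) (g (g x)) := by
  have hxl : dist x (g x) = translationLength g := hx
  have hpos : 0 < dist x (g x) := hxl ▸ hg
  -- The midpoint also has displacement `l(g)`, which is the length of the path from `m` to `g m`
  -- through `g x`; so there is no corner at `g x`.
  obtain ⟨m, hm, hmd⟩ := hT.exists_btw x (g x) (t := dist x (g x) / 2)
    (by positivity) (by linarith)
  have hml : dist m (g m) = translationLength g := RTree.mem_axis_of_btw hx hm
  have hgm : dist (g x) (g m) = dist x m := g.isometry.dist_eq _ _
  have h1 : Btw m (g x) (g m) := by
    unfold Btw at *
    linarith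
  have hne : m ≠ g x := by
    rintro rfl
    linarith
  have h2 := (hT.btw_concat hm h1 hne).2
  refine (hT.btw_concat h2 (hm.map g) ?_).1
  rw [← dist_pos, hgm]
  linarith

/-- Distances to a fixed point `w` are controlled along a segment by those at its endpoints. -/
theorem IsRTree.dist_le_of_btw {x y z w : T} (h : Btw x z y) :
    dist z w ≤ max (dist x w - dist x z) (dist y w - dist y z) := by
  have := hT.four_point x y z w
  unfold Btw at h
  rw [dist_comm z y] at h
  rcases le_max_iff.1 this with h1 | h1
  · exact le_max_of_le_right (by linarith)
  · exact le_max_of_le_left (by linarith)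

/-- The distance from `z` to `g z` is controlled by those from `x` and `y` to `g z`, and these in
turn by the distances to `g x` and `g y`. -/
theorem IsRTree.axis_convex {g : T ≃ᵢ T} {x y z : T} (hx : x ∈ axis g) (hy : y ∈ axis g)
    (h : Btw x z y) : z ∈ axis g := by
  refine le_antisymm ?_ (translationLength_le g z)
  have hx' : dist x (g x) = translationLength g := hx
  have hy' : dist y (g y) = translationLength g := hy
  have h0 := hT.dist_le_of_btw (w := g z) h
  have h1 := hT.dist_le_of_btw (w := x) (h.map g)
  have h2 := hT.dist_le_of_btw (w := y) (h.map g)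
  simp only [g.isometry.dist_eq] at h1 h2
  rw [dist_comm _ x, dist_comm _ x, dist_comm _ x] at h1
  rw [dist_comm _ y, dist_comm _ y, dist_comm _ y] at h2
  have h3 := dist_triangle x (g x) (g y)
  have h4 := dist_triangle y (g y) (g x)
  rw [g.isometry.dist_eq] at h3 h4
  have h5 := dist_comm z y
  have h6 := dist_comm x y
  have h7 := dist_nonneg (x := x) (y := z)
  have h8 := dist_nonneg (x := y) (y := z)
  unfold Btw at h
  rcases le_max_iff.1 h0 with h0 | h0 <;> rcases le_max_iff.1 h1 with h1 | h1 <;>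
    rcases le_max_iff.1 h2 with h2 | h2 <;> linarith

/-- Far enough translates of `o` enclose any given point `x` of the axis. -/
theorem IsRTree.btw_pow_of_mem_axis {g : T ≃ᵢ T} (hg : IsHyperbolic g) {o x : T}
    (ho : o ∈ axis g) (hx : x ∈ axis g) {n : ℕ} (hn : dist x o < n * translationLength g) :
    Btw ((g ^ n).symm o) x ((g ^ n) o) := by
  have h1 := hT.dist_pow_of_btw (hT.btw_of_mem_axis hg hx) n
  have h2 := hT.dist_pow_of_btw (hT.btw_of_mem_axis hg ho) n
  have h3 : dist ((g ^ n).symm o) ((g ^ n) o) = 2 * n * translationLength g := by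
    have h := hT.dist_pow_of_btw (hT.btw_of_mem_axis hg ho) (n + n)
    rw [ho, pow_add] at h
    rw [← (g ^ n).isometry.dist_eq, IsometryEquiv.apply_symm_apply]
    refine h.trans ?_
    push_cast
    ring
  rw [hx] at h1
  rw [ho] at h2
  have h4 := hT.four_point x ((g ^ n) o) ((g ^ n) x) o
  have h5 : dist ((g ^ n) x) o = dist ((g ^ n).symm o) x := by
    rw [← (g ^ n).isometry.dist_eq ((g ^ n).symm o), IsometryEquiv.apply_symm_apply, dist_comm]
  have h6 := dist_triangle ((g ^ n).symm o) x ((g ^ n) o)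
  rw [dist_comm ((g ^ n) o) o, dist_comm ((g ^ n) o), (g ^ n).isometry.dist_eq] at h4
  unfold Btw
  rcases le_max_iff.1 h4 with h4 | h4 <;> linarith

/-- The axis of a hyperbolic isometry is a line, on which the isometry acts by translation. -/
theorem IsRTree.exists_axis_param {g : T ≃ᵢ T} (hg : IsHyperbolic g) :
    ∃ f : ℝ → T, Isometry f ∧ Set.range f = axis g ∧
      ∀ t, g (f t) = f (t + translationLength g) := by
  obtain ⟨o, ho⟩ := hT.exists_mem_axis hg
  have hl : 0 < translationLength g := hg
  set l := translationLength g
  -- Backward translates of `o`, used as a sequence of origins: the coordinate of `x` is the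
  -- eventual value of `dist (p n) x - n * l`, with `o` at `0`.
  let p : ℕ → T := fun n => (g ^ n).symm o
  have hgp : ∀ n, g (p (n + 1)) = p n := by
    intro n
    apply (g ^ n).injective
    rw [← pow_succ_apply']
    simp [p]
  have hpo : ∀ n, dist (p n) o = n * l := by
    intro n
    rw [← (g ^ n).isometry.dist_eq, IsometryEquiv.apply_symm_apply,
      hT.dist_pow_of_btw (hT.btw_of_mem_axis hg ho) n, ho]
  have hpA : ∀ n, p n ∈ axis g := by
    intro n
    induction n with
    | zero => exact ho
    | succ n ih => rwa [← map_mem_axis_iff, hgp]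
  have hqA : ∀ n, (g ^ n) o ∈ axis g := by
    intro n
    induction n with
    | zero => exact ho
    | succ n ih => rwa [pow_succ_apply, map_mem_axis_iff]
  have hbig : ∀ x ∈ axis g, ∀ᶠ n : ℕ in Filter.atTop, Btw (p n) x ((g ^ n) o) := by
    intro x hx
    obtain ⟨N, hN⟩ := exists_nat_gt (dist x o / l)
    rw [div_lt_iff₀ hl] at hN
    filter_upwards [Filter.eventually_ge_atTop N] with n hn
    refine hT.btw_pow_of_mem_axis hg ho hx (hN.trans_le ?_)
    have : (N : ℝ) ≤ n := by exact_mod_cast hn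
    gcongr
  -- `R x t` says that `t` is the coordinate of `x` on the axis
  let R : T → ℝ → Prop := fun x t => ∀ᶠ n : ℕ in Filter.atTop, dist (p n) x = t + n * l
  have hpp : ∀ m n : ℕ, n ≤ m → dist (p m) (p n) = (m - n) * l := by
    intro m n hmn
    obtain ⟨k, rfl⟩ := Nat.exists_eq_add_of_le hmn
    have h1 : p n = (g ^ k) (p (n + k)) := by
      apply (g ^ n).injective
      change _ = (g ^ n * g ^ k) (p (n + k))
      rw [← pow_add]
      simp [p]
    rw [h1, hT.dist_pow_of_btw (hT.btw_of_mem_axis hg (hpA _)) k, hpA]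
    push_cast
    ring
  have hpq : ∀ m n : ℕ, dist (p m) ((g ^ n) o) = (m + n) * l := by
    intro m n
    have h1 : (g ^ n) o = (g ^ (n + m)) (p m) := by
      rw [pow_add]
      change _ = (g ^ n) ((g ^ m) (p m))
      simp [p]
    rw [h1, hT.dist_pow_of_btw (hT.btw_of_mem_axis hg (hpA _)), hpA]
    push_cast
    ring
  have hR : ∀ x, ∀ N : ℕ, dist x o < N * l → x ∈ axis g → R x (dist (p N) x - N * l) := by
    intro x N hN hx
    have h1 := hT.btw_pow_of_mem_axis hg ho hx hN
    filter_upwards [Filter.eventually_ge_atTop N] with m hm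
    have h4 : Btw (p m) (p N) ((g ^ N) o) := by
      unfold Btw
      rw [hpp m N hm, hpq, hpq]
      ring
    have h5 := (h4.trans_right h1).2
    unfold Btw at h5
    rw [← h5, hpp m N hm]
    ring
  have hRdist : ∀ x ∈ axis g, ∀ y ∈ axis g, ∀ s t, R x s → R y t → dist x y = |s - t| := by
    intro x hx y hy s t hs ht
    obtain ⟨n, h1, h2, h3, h4⟩ := (hs.and (ht.and ((hbig x hx).and (hbig y hy)))).exists
    rw [hT.dist_eq_of_btw h3 h4, h1, h2]
    congr 1
    ring
  have hRsurj : ∀ t, ∃ x, x ∈ axis g ∧ R x t := by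
    intro t
    obtain ⟨N, hN⟩ := exists_nat_gt (|t| / l)
    rw [div_lt_iff₀ hl, abs_lt] at hN
    have hd : dist (p N) ((g ^ N) o) = N * l + N * l := by
      rw [hpq]
      ring
    obtain ⟨x, hx, hxd⟩ := hT.exists_btw (p N) ((g ^ N) o) (t := t + N * l) (by linarith)
      (by linarith)
    have hxA := hT.axis_convex (hpA N) (hqA N) hx
    refine ⟨x, hxA, ?_⟩
    have ho' : Btw (p N) o ((g ^ N) o) := by
      have h1 := hT.dist_pow_of_btw (hT.btw_of_mem_axis hg ho) N
      rw [ho] at h1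
      unfold Btw
      rw [hpo, hd, h1]
    have h1 := hT.dist_eq_of_btw hx ho'
    rw [hxd, hpo] at h1
    have := hR x N (by rw [h1, abs_lt]; constructor <;> linarith) hxA
    rwa [hxd, add_sub_cancel_right] at this
  choose f hfA hfR using hRsurj
  refine ⟨f, ?_, ?_, ?_⟩
  · refine Isometry.of_dist_eq fun s t => ?_
    rw [hRdist _ (hfA s) _ (hfA t) s t (hfR s) (hfR t), Real.dist_eq]
  · refine Set.Subset.antisymm (Set.range_subset_iff.2 hfA) fun x hx => ?_
    obtain ⟨N, hN⟩ := exists_nat_gt (dist x o / l)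
    rw [div_lt_iff₀ hl] at hN
    refine ⟨dist (p N) x - N * l, dist_eq_zero.1 ?_⟩
    rw [hRdist _ (hfA _) x hx _ _ (hfR _) (hR x N hN hx), sub_self, abs_zero]
  · intro t
    have h1 : R (g (f t)) (t + l) := by
      filter_upwards [(Filter.tendsto_add_atTop_nat 1).eventually (hfR t)] with n hn
      rw [← hgp, g.isometry.dist_eq, hn]
      push_cast
      ring
    rw [← dist_eq_zero, hRdist _ (map_mem_axis (hfA t)) _ (hfA _) _ _ h1 (hfR _), sub_self,
      abs_zero]

end TranslationLength
-- Disjoint axes, crossing at a point, and equal directions.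
section Products

variable {T : Type*} [MetricSpace T]

/-- The direction of translation on a parametrized axis. -/
theorem translatesTowards_param_iff {g : T ≃ᵢ T} {f : ℝ → T} (hf : Isometry f) {l : ℝ}
    (hl : 0 < l) (hgf : ∀ t, g (f t) = f (t + l)) (s t : ℝ) :
    TranslatesTowards g (f s) (f t) ↔ s ≤ t := by
  have hpow : ∀ n : ℕ, (g ^ n) (f s) = f (s + n * l) := by
    intro n
    induction n with
    | zero => simp
    | succ n ih =>
      rw [pow_succ_apply, ih, hgf]
      push_cast
      ring_nf
  unfold TranslatesTowards
  simp only [hpow, hf.dist_eq, Real.dist_eq]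
  constructor
  · rintro ⟨n, hn⟩
    have h0 : 0 ≤ n * l := by positivity
    have h1 := le_abs_self (s - t)
    have h2 := neg_abs_le (t - (s + n * l))
    rw [abs_of_nonpos (show s - (s + n * l) ≤ 0 by linarith)] at hn
    linarith
  · intro hst
    obtain ⟨n, hn⟩ := exists_nat_gt ((t - s) / l)
    rw [div_lt_iff₀ hl] at hn
    refine ⟨n, ?_⟩
    rw [abs_of_nonpos (by linarith), abs_of_nonpos (by linarith), abs_of_nonpos (by linarith)]
    ring

theorem symm_mem_axis {g : T ≃ᵢ T} {x : T} (hx : x ∈ axis g) : g.symm x ∈ axis g := by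
  rwa [← map_mem_axis_iff, IsometryEquiv.apply_symm_apply]

theorem IsHyperbolic.apply_ne {g : T ≃ᵢ T} (hg : IsHyperbolic g) (x : T) : g x ≠ x := by
  intro h
  exact absurd hg (by simp [IsHyperbolic, translationLength_eq_zero_of_fixed h])

variable (hT : IsRTree T)
include hT

/-- Applying `γ` and `δ` alternately to the two hypotheses aligns `u`, `γ v`, `γ (δ u)`, `γ (δ (γ
v))`, and so on; the inequalities keep consecutive overlaps nontrivial. -/
theorem IsRTree.translationLength_mul_of_btw {γ δ : T ≃ᵢ T} {u v : T}
    (h₁ : Btw (γ.symm u) v (δ u)) (h₂ : Btw (δ.symm v) u (γ v)) (hu : γ v ≠ u) (hv : δ u ≠ v) :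
    Btw u (γ v) ((γ * δ) u) ∧ u ∈ axis (γ * δ) ∧
      translationLength (γ * δ) = dist u (γ v) + dist v (δ u) := by
  have h1 : Btw u (γ v) (γ (δ u)) := by simpa using h₁.map γ
  have h2 : Btw v (δ u) (δ (γ v)) := by simpa using h₂.map δ
  have h3 : Btw u (γ (δ u)) (γ (δ (γ v))) :=
    (hT.btw_concat h1 (h2.map γ) (fun h => hv (γ.injective h).symm)).2
  have h4 : Btw (γ (δ u)) (γ (δ (γ v))) (γ (δ (γ (δ u)))) := (h1.map δ).map γ
  have h5 := (hT.btw_concat h3 h4 fun h => hu (δ.injective (γ.injective h)).symm).1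
  refine ⟨h1, hT.mem_axis_of_btw h5, (hT.translationLength_of_btw h5).trans ?_⟩
  rw [← γ.isometry.dist_eq v]
  exact Eq.symm h1

/-- If the segments `[x, y]` and `[y, z]` meet only in `y`, then `y` is between `x` and `z`. -/
theorem IsRTree.btw_of_inter {x y z : T} (h : ∀ m, Btw x m y → Btw y m z → m = y) :
    Btw x y z := by
  obtain ⟨m, h1, h2, h3⟩ := hT.exists_median x y z
  rwa [← h m h1 h3]

/-- If `p` is the projection of `q` to the axis of `g`, it is between `q` and its translates. -/
theorem IsRTree.btw_symm_of_projection {g : T ≃ᵢ T} (hg : IsHyperbolic g) {p q : T}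
    (hp : p ∈ axis g) (h : ∀ x ∈ axis g, Btw x p q) : Btw (g.symm q) p q := by
  have h1 : Btw (g.symm q) (g.symm p) p := by
    simpa using (h _ (map_mem_axis hp)).symm.map g.symm
  refine (hT.btw_concat h1 (h _ (symm_mem_axis hp)) fun h2 => hg.apply_ne p ?_).2
  rw [← h2, IsometryEquiv.apply_symm_apply, h2]

/-- The ends of `S` are the projections of each other to the axes, so the previous criterion applies
with `u = q`, `v = p`. The order `q, p, γ p, γ (δ q)` then puts `S` on the new axis. -/
theorem IsRTree.isConnectingArc_axis {γ δ : T ≃ᵢ T} (hγ : IsHyperbolic γ) (hδ : IsHyperbolic δ)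
    (hdisj : axis γ ∩ axis δ = ∅) {S : Set T} {p q : T}
    (hS : IsConnectingArc S (axis γ) (axis δ) p q) :
    IsHyperbolic (γ * δ) ∧ S ⊆ axis (γ * δ) ∧ TranslatesTowards (γ * δ) q p ∧
      translationLength (γ * δ) = translationLength γ + translationLength δ + 2 * dist p q := by
  obtain ⟨hseg, hSγ, hSδ⟩ := hS
  have hp : p ∈ axis γ := (hSγ.symm.subset rfl).2
  have hq : q ∈ axis δ := (hSδ.symm.subset rfl).2
  have hnotin : ∀ x ∈ axis γ, x ∉ axis δ := fun x h h' => (hdisj.subset ⟨h, h'⟩ : x ∈ (∅ : Set T))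
  have hpq : p ≠ q := fun h => hnotin p hp (h ▸ hq)
  have b1 : ∀ x ∈ axis γ, Btw x p q := fun x hx => hT.btw_of_inter fun m h1 h2 =>
    hSγ.subset ⟨(hT.mem_segment_iff hseg).2 h2, hT.axis_convex hx hp h1⟩
  have b2 : ∀ x ∈ axis δ, Btw x q p := fun x hx => hT.btw_of_inter fun m h1 h2 =>
    hSδ.subset ⟨(hT.mem_segment_iff hseg).2 h2.symm, hT.axis_convex hx hq h1⟩
  have c1 := b1 _ (map_mem_axis hp)
  have c2 := b2 _ (map_mem_axis hq)
  have h1 : Btw (γ.symm q) p (δ q) :=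
    (hT.btw_concat (hT.btw_symm_of_projection hγ hp b1) c2.symm hpq).1
  have h2 : Btw (δ.symm p) q (γ p) :=
    (hT.btw_concat (hT.btw_symm_of_projection hδ hq b2) c1.symm hpq.symm).1
  obtain ⟨h3, h4, h5⟩ := hT.translationLength_mul_of_btw h1 h2
    (fun h => hnotin _ (map_mem_axis hp) (h ▸ hq)) (fun h => hnotin p hp (h ▸ map_mem_axis hq))
  have hl : translationLength (γ * δ) =
      translationLength γ + translationLength δ + 2 * dist p q := by
    have hp' : dist p (γ p) = translationLength γ := hp
    have hq' : dist q (δ q) = translationLength δ := hq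
    have c1' := c1.symm
    have c2' := c2.symm
    unfold Btw at c1' c2'
    rw [h5, ← c1', ← c2', hp', hq', dist_comm q p]
    ring
  have hqp : ∀ z, Btw q z p → Btw q z ((γ * δ) q) := fun z hz =>
    (h3.trans_left (c1.symm.trans_left hz).1).1
  refine ⟨?_, fun z hz => ?_, ⟨1, ?_⟩, hl⟩
  · have : 0 ≤ dist p q := dist_nonneg
    unfold IsHyperbolic at *
    linarith
  · exact RTree.mem_axis_of_btw h4 (hqp z (hseg.btw hz).symm)
  · rw [pow_one]
    exact hqp p (btw_self_right _ _)

theorem IsRTree.exists_isConnectingArc {γ δ : T ≃ᵢ T} (hγ : IsHyperbolic γ)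
    (hδ : IsHyperbolic δ) :
    ∃ (S : Set T) (p q : T), IsConnectingArc S (axis γ) (axis δ) p q := by
  obtain ⟨x, hx⟩ := hT.exists_mem_axis hγ
  obtain ⟨y, hy⟩ := hT.exists_mem_axis hδ
  obtain ⟨S₁, hS₁⟩ := hT.exists_segment x y
  -- `p` is the last point of the axis of `γ` on `[x, y]`, and `q` the first point of the axis of
  -- `δ` after it.
  obtain ⟨p, hp, hpmax⟩ := (hS₁.isCompact.inter_right (isClosed_axis γ)).exists_isMaxOn
    ⟨x, (hT.mem_segment_iff hS₁).2 (btw_self_left _ _), hx⟩ (f := fun w => dist x w) (by fun_prop)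
  obtain ⟨S₂, hS₂⟩ := hT.exists_segment p y
  obtain ⟨q, hq, hqmin⟩ := (hS₂.isCompact.inter_right (isClosed_axis δ)).exists_isMinOn
    ⟨y, (hT.mem_segment_iff hS₂).2 (btw_self_right _ _), hy⟩ (f := fun w => dist p w)
    (by fun_prop)
  obtain ⟨S, hS⟩ := hT.exists_segment p q
  have hsub : ∀ z ∈ S, Btw p z y := fun z hz => ((hS₂.btw hq.1).trans_left (hS.btw hz)).1
  refine ⟨S, p, q, hS, Set.Subset.antisymm (fun z hz => ?_) ?_,
    Set.Subset.antisymm (fun z hz => ?_) ?_⟩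
  · obtain ⟨h1, h2⟩ := (hS₁.btw hp.1).trans_right (hsub z hz.1)
    have h3 : dist x z ≤ dist x p := hpmax ⟨(hT.mem_segment_iff hS₁).2 h1, hz.2⟩
    unfold Btw at h2
    exact (dist_le_zero.1 (by linarith : dist p z ≤ 0)).symm
  · rintro z rfl
    exact ⟨(hT.mem_segment_iff hS).2 (btw_self_left _ _), hp.2⟩
  · have h1 : dist p q ≤ dist p z := hqmin ⟨(hT.mem_segment_iff hS₂).2 (hsub z hz.1), hz.2⟩
    have h2 := hS.btw hz.1
    unfold Btw at h2
    exact dist_le_zero.1 (by linarith : dist z q ≤ 0)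
  · rintro z rfl
    exact ⟨(hT.mem_segment_iff hS).2 (btw_self_right _ _), hq.2⟩

/-- If `γ` and `δ` translate away from `p` without backtracking, translation lengths add up. -/
theorem IsRTree.translationLength_mul_of_mem_axes {γ δ : T ≃ᵢ T} (hγ : IsHyperbolic γ)
    (hδ : IsHyperbolic δ) {p : T} (hpγ : p ∈ axis γ) (hpδ : p ∈ axis δ)
    (h₁ : Btw (γ.symm p) p (δ p)) (h₂ : Btw (δ.symm p) p (γ p)) :
    translationLength (γ * δ) = translationLength γ + translationLength δ := by
  rw [(hT.translationLength_mul_of_btw h₁ h₂ (hγ.apply_ne p) (hδ.apply_ne p)).2.2, hpγ, hpδ]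

theorem IsRTree.translationLength_mul_of_inter_subsingleton {γ δ : T ≃ᵢ T} (hγ : IsHyperbolic γ)
    (hδ : IsHyperbolic δ) (hne : (axis γ ∩ axis δ).Nonempty)
    (hss : (axis γ ∩ axis δ).Subsingleton) :
    translationLength (γ * δ) = translationLength γ + translationLength δ := by
  obtain ⟨p, hpγ, hpδ⟩ := hne
  have key : ∀ x ∈ axis γ, ∀ y ∈ axis δ, Btw x p y := fun x hx y hy =>
    hT.btw_of_inter fun m h1 h2 =>
      hss ⟨hT.axis_convex hx hpγ h1, hT.axis_convex hpδ hy h2⟩ ⟨hpγ, hpδ⟩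
  exact hT.translationLength_mul_of_mem_axes hγ hδ hpγ hpδ
    (key _ (symm_mem_axis hpγ) _ (map_mem_axis hpδ))
    (key _ (map_mem_axis hpγ) _ (symm_mem_axis hpδ)).symm

theorem IsRTree.translationLength_mul_of_sameDirection {γ δ : T ≃ᵢ T} (hγ : IsHyperbolic γ)
    (hδ : IsHyperbolic δ) (hnt : (axis γ ∩ axis δ).Nontrivial)
    (hdir : SameDirectionOn γ δ (axis γ ∩ axis δ)) :
    translationLength (γ * δ) = translationLength γ + translationLength δ := by
  obtain ⟨f, hf, hfr, hγf⟩ := hT.exists_axis_param hγ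
  obtain ⟨h, hh, hhr, hδh⟩ := hT.exists_axis_param hδ
  -- two common points, in the order given by the translation directions
  obtain ⟨s, t, s', t', hst, hst', hs, ht⟩ :
      ∃ s t s' t' : ℝ, s < t ∧ s' < t' ∧ f s = h s' ∧ f t = h t' := by
    obtain ⟨x, hx, y, hy, hxy⟩ := hnt
    have hd := hdir x hx y hy
    obtain ⟨s, rfl⟩ := hfr.symm.subset hx.1
    obtain ⟨t, rfl⟩ := hfr.symm.subset hy.1
    obtain ⟨s', hs⟩ := hhr.symm.subset hx.2
    obtain ⟨t', ht⟩ := hhr.symm.subset hy.2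
    rw [translatesTowards_param_iff hf hγ hγf, ← hs, ← ht,
      translatesTowards_param_iff hh hδ hδh] at hd
    have h1 : s ≠ t := fun h => hxy (by rw [h])
    have h2 : s' ≠ t' := fun h => hxy (by rw [← hs, ← ht, h])
    rcases lt_or_gt_of_ne h1 with h3 | h3
    · exact ⟨s, t, s', t', h3, lt_of_le_of_ne (hd.1 h3.le) h2, hs.symm, ht.symm⟩
    · refine ⟨t, s, t', s', h3, ?_, ht.symm, hs.symm⟩
      by_contra! h4
      exact absurd (hd.2 h4) (not_le.2 h3)
  have hts : t - s = t' - s' := by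
    have h1 := hf.dist_eq s t
    rw [hs, ht, hh.dist_eq, Real.dist_eq, Real.dist_eq, abs_of_neg (by linarith),
      abs_of_neg (by linarith)] at h1
    linarith
  have hγs : γ.symm (f s) = f (s - translationLength γ) := by
    rw [γ.symm_apply_eq, hγf, sub_add_cancel]
  have hδs : δ.symm (h s') = h (s' - translationLength δ) := by
    rw [δ.symm_apply_eq, hδh, sub_add_cancel]
  have hγ' : 0 < translationLength γ := hγ
  have hδ' : 0 < translationLength δ := hδ
  -- The common piece of length `d` may be longer or shorter than the step `c'`: the geodesic is cut
  -- or prolonged accordingly.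
  have aux : ∀ {f h : ℝ → T} {s s' d c c' : ℝ}, Isometry f → Isometry h → f s = h s' → 0 < d →
      f (s + d) = h (s' + d) → 0 < c → 0 < c' → Btw (f (s - c)) (h s') (h (s' + c')) := by
    intro f h s s' d c c' hf hh h0 hd h1 hc hc'
    have h2 : Btw (f (s - c)) (h s') (h (s' + d)) := by
      rw [← h0, ← h1]
      exact btw_of_isometry hf (by linarith) (by linarith)
    rcases le_total c' d with hcd | hcd
    · exact (h2.symm.trans_left (w := h (s' + c'))
        (btw_of_isometry_anti hh (by linarith) (by linarith))).2.symm
    · refine (hT.btw_concat h2 (w := h (s' + c')) (btw_of_isometry hh (by linarith)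
        (by linarith)) fun h3 => ?_).1
      linarith [hh.injective h3]
  refine hT.translationLength_mul_of_mem_axes hγ hδ (p := f s) (hfr.subset ⟨s, rfl⟩)
    (hhr.subset ⟨s', hs.symm⟩) ?_ ?_
  · rw [hγs, hs, hδh]
    exact aux (d := t - s) hf hh hs (by linarith) (by convert ht using 2 <;> linarith) hγ' hδ'
  · rw [hγf, hs, hδs, ← hs]
    exact aux (d := t - s) hh hf hs.symm (by linarith) (by convert ht.symm using 2 <;> linarith)
      hδ' hγ'

end Products

/-! ### Diameters of sets of parameters. -/

theorem exists_eq_Icc_of_ediam_ne_top {J : Set ℝ} (hne : J.Nonempty) (hcl : IsClosed J)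
    (hoc : J.OrdConnected) (hD : Metric.ediam J ≠ ⊤) :
    ∃ p q, p ≤ q ∧ J = Set.Icc p q ∧ Metric.ediam J = ENNReal.ofReal (q - p) := by
  have hb : Bornology.IsBounded J := Metric.isBounded_iff_ediam_ne_top.2 hD
  have hcpt : IsCompact J := Metric.isCompact_of_isClosed_isBounded hcl hb
  obtain ⟨p, hp⟩ := hcpt.exists_isLeast hne
  obtain ⟨q, hq⟩ := hcpt.exists_isGreatest hne
  have hJ : J = Set.Icc p q :=
    Set.Subset.antisymm (fun x hx => ⟨hp.2 hx, hq.2 hx⟩) (hoc.out hp.1 hq.1)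
  exact ⟨p, q, hp.2 hq.1, hJ, by rw [hJ, Real.ediam_Icc]⟩

theorem exists_lt_sub_of_lt_ediam {J : Set ℝ} {a : ℝ} (ha : ENNReal.ofReal a < Metric.ediam J) :
    ∃ p ∈ J, ∃ q ∈ J, p < q ∧ a < q - p := by
  by_contra! hcon
  refine absurd ha (not_lt.2 (Metric.ediam_le fun x hx y hy => ?_))
  rw [edist_dist, Real.dist_eq]
  rcases lt_trichotomy x y with h | rfl | h
  · rw [abs_of_neg (by linarith)]
    exact ENNReal.ofReal_le_ofReal (by linarith [hcon x hx y hy h])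
  · simp
  · rw [abs_of_pos (by linarith)]
    exact ENNReal.ofReal_le_ofReal (by linarith [hcon y hy x hx h])

/-! ### Opposite directions: matched parametrizations and generic overlaps. -/

section Opposite

variable {T : Type*} [MetricSpace T]

/-- Parametrizations `f` and `h` of the axes of `γ` and `δ` which agree wherever the axes meet,
the parameter increasing in the direction of translation of `γ` and decreasing in the direction
of translation of `δ`. -/
structure OppositeParam (γ δ : T ≃ᵢ T) (f h : ℝ → T) : Prop where
  isometry_left : Isometry f
  isometry_right : Isometry h
  range_left : Set.range f = axis γ
  range_right : Set.range h = axis δ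
  map_left : ∀ t, γ (f t) = f (t + translationLength γ)
  map_right : ∀ t, δ (h t) = h (t - translationLength δ)
  eq_of_eq : ∀ s t, f s = h t → s = t

theorem IsRTree.exists_oppositeParam (hT : IsRTree T) {γ δ : T ≃ᵢ T} (hγ : IsHyperbolic γ)
    (hδ : IsHyperbolic δ) (hnt : (axis γ ∩ axis δ).Nontrivial)
    (hdir : OppositeDirectionOn γ δ (axis γ ∩ axis δ)) : ∃ f h, OppositeParam γ δ f h := by
  obtain ⟨f, hf, hfr, hγf⟩ := hT.exists_axis_param hγ
  obtain ⟨h, hh, hhr, hδh⟩ := hT.exists_axis_param hδ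
  have hI : ∀ {s t}, f s = h t → f s ∈ axis γ ∩ axis δ := fun {s t} hst =>
    ⟨hfr.subset ⟨s, rfl⟩, hhr.subset ⟨t, hst.symm⟩⟩
  have hd : ∀ {s s' t t'}, f s = h s' → f t = h t' → (s ≤ t ↔ t' ≤ s') := by
    intro s s' t t' hs ht
    have := hdir _ (hI hs) _ (hI ht)
    rwa [translatesTowards_param_iff hf hγ hγf, hs, ht,
      translatesTowards_param_iff hh hδ hδh] at this
  have hsum : ∀ {s s' t t'}, f s = h s' → f t = h t' → s + s' = t + t' := by
    intro s s' t t' hs ht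
    have h1 := hf.dist_eq s t
    rw [hs, ht, hh.dist_eq, Real.dist_eq, Real.dist_eq] at h1
    rcases le_total s t with h2 | h2
    · rw [abs_of_nonneg (by linarith [(hd hs ht).1 h2]), abs_of_nonpos (by linarith)] at h1
      linarith
    · rw [abs_of_nonpos (by linarith [(hd ht hs).1 h2]), abs_of_nonneg (by linarith)] at h1
      linarith
  obtain ⟨x, hx⟩ := hnt.nonempty
  obtain ⟨s, rfl⟩ := hfr.symm.subset hx.1
  obtain ⟨s', hs⟩ := hhr.symm.subset hx.2
  -- By `hsum`, the two coordinates of a common point have constant sum `s + s'`, so this reflection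
  -- of `h` makes them equal.
  refine ⟨f, fun t => h (s + s' - t), hf, ?_, hfr, ?_, hγf, fun t => ?_, fun u t hut => ?_⟩
  · refine Isometry.of_dist_eq fun u t => ?_
    rw [hh.dist_eq, Real.dist_eq, Real.dist_eq, ← abs_neg]
    ring_nf
  · rw [← hhr]
    exact (Equiv.subLeft (s + s')).surjective.range_comp h
  · rw [hδh]
    ring_nf
  · linarith [hsum hs.symm hut]

variable {γ δ : T ≃ᵢ T} {f h : ℝ → T} (H : OppositeParam γ δ f h)
include H

namespace OppositeParam

theorem symm_left (t : ℝ) : γ.symm (f t) = f (t - translationLength γ) := by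
  rw [γ.symm_apply_eq, H.map_left, sub_add_cancel]

theorem symm_right (t : ℝ) : δ.symm (h t) = h (t + translationLength δ) := by
  rw [δ.symm_apply_eq, H.map_right, add_sub_cancel_right]

theorem mem_left (t : ℝ) : f t ∈ axis γ := H.range_left.subset ⟨t, rfl⟩

theorem mem_right (t : ℝ) : h t ∈ axis δ := H.range_right.subset ⟨t, rfl⟩

theorem eq_of_mem {t : ℝ} (ht : f t ∈ axis δ) : f t = h t := by
  obtain ⟨s, hs⟩ := H.range_right.symm.subset ht
  rw [← hs, ← H.eq_of_eq _ _ hs.symm]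

theorem inter_eq_image : axis γ ∩ axis δ = f '' {t | f t = h t} := by
  ext x
  constructor
  · rintro ⟨hx, hx'⟩
    obtain ⟨t, rfl⟩ := H.range_left.symm.subset hx
    exact ⟨t, H.eq_of_mem hx', rfl⟩
  · rintro ⟨t, ht, rfl⟩
    exact ⟨H.mem_left t, by rw [show f t = h t from ht]; exact H.mem_right t⟩

theorem segmentLength_inter : segmentLength (axis γ ∩ axis δ) = Metric.ediam {t | f t = h t} := by
  rw [segmentLength, H.inter_eq_image, H.isometry_left.ediam_image]

theorem isClosed_coincidence : IsClosed {t | f t = h t} :=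
  isClosed_eq H.isometry_left.continuous H.isometry_right.continuous

theorem translationLength_mul_eq_zero {p : ℝ} (hab : translationLength γ = translationLength δ)
    (hp : f p = h p) (hpa : f (p + translationLength γ) = h (p + translationLength γ)) :
    translationLength (γ * δ) = 0 := by
  refine translationLength_eq_zero_of_fixed (x := f (p + translationLength γ)) ?_
  change γ (δ _) = _
  rw [hpa, H.map_right, hab, add_sub_cancel_right, ← hp, H.map_left, ← hab, hpa]

variable (hT : IsRTree T)
include hT

theorem eq_of_le_of_le {r s t : ℝ} (hr : f r = h r) (ht : f t = h t) (hrs : r ≤ s)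
    (hst : s ≤ t) : f s = h s := by
  refine hT.eq_of_btw (btw_of_isometry H.isometry_left hrs hst) ?_ ?_ (x := f r) (y := f t)
  · rw [hr, ht]
    exact btw_of_isometry H.isometry_right hrs hst
  · rw [hr, H.isometry_right.dist_eq, ← hr, H.isometry_left.dist_eq]

theorem ordConnected_coincidence : {t | f t = h t}.OrdConnected :=
  ⟨fun _ hr _ ht _ hs => H.eq_of_le_of_le hT hr ht hs.1 hs.2⟩

/-- The axes separate at an extremity of their intersection. -/
theorem btw_of_coincidence {q s t : ℝ} (hq : f q = h q)
    (hlt : ∀ r ∈ Set.uIcc q s, f r = h r → r = q) : Btw (f s) (h q) (h t) := by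
  refine hT.btw_of_inter fun m h1 h2 => ?_
  rw [← hq] at h1
  have hm := hT.axis_convex (H.mem_left s) (H.mem_left q) h1
  have hm' := hT.axis_convex (H.mem_right q) (H.mem_right t) h2
  obtain ⟨r, rfl⟩ := H.range_left.symm.subset hm
  have hr := H.eq_of_mem hm'
  rw [← hq, hlt r ?_ hr]
  unfold Btw at h1
  simp only [H.isometry_left.dist_eq, Real.dist_eq] at h1
  rw [Set.mem_uIcc]
  rcases le_total q s with h3 | h3
  · left
    rw [abs_of_nonneg (show 0 ≤ s - q by linarith)] at h1
    constructor <;> linarith [le_abs_self (s - r), le_abs_self (r - q), neg_abs_le (s - r),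
      neg_abs_le (r - q)]
  · right
    rw [abs_of_nonpos (show s - q ≤ 0 by linarith)] at h1
    constructor <;> linarith [le_abs_self (s - r), le_abs_self (r - q), neg_abs_le (s - r),
      neg_abs_le (r - q)]

/-- Overlap shorter than both translation lengths. -/
theorem translationLength_mul_of_lt {p q : ℝ} (hpq : p ≤ q)
    (hJ : {t | f t = h t} = Set.Icc p q) (ha : q - p < translationLength γ)
    (hb : q - p < translationLength δ) : translationLength (γ * δ) =
      translationLength γ + translationLength δ - 2 * (q - p) := by
  have hp : f p = h p := hJ.symm.subset ⟨le_rfl, hpq⟩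
  have hq : f q = h q := hJ.symm.subset ⟨hpq, le_rfl⟩
  have hmem : ∀ r, f r = h r → p ≤ r ∧ r ≤ q := fun r hr => hJ.subset hr
  have h1 : Btw (γ.symm (f q)) (h p) (δ (f q)) := by
    rw [H.symm_left, hq, H.map_right]
    refine H.btw_of_coincidence hT hp fun r hr hr' => ?_
    rw [Set.uIcc_of_ge (by linarith)] at hr
    exact le_antisymm hr.2 (hmem r hr').1
  have h2 : Btw (δ.symm (h p)) (f q) (γ (h p)) := by
    rw [H.symm_right, ← hp, H.map_left, hq]
    refine (H.btw_of_coincidence hT hq fun r hr hr' => ?_).symm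
    rw [Set.uIcc_of_le (by linarith)] at hr
    exact le_antisymm (hmem r hr').2 hr.1
  rw [(hT.translationLength_mul_of_btw h1 h2 ?_ ?_).2.2]
  · rw [← hp, H.map_left, hp, hq, H.map_right, H.isometry_right.dist_eq, ← hq,
      H.isometry_left.dist_eq, Real.dist_eq, Real.dist_eq, abs_of_neg (by linarith),
      abs_of_pos (by linarith)]
    ring
  · rw [← hp, H.map_left]
    exact fun h => by linarith [H.isometry_left.injective h]
  · rw [hq, H.map_right]
    exact fun h => by linarith [H.isometry_right.injective h]

theorem translationLength_mul_lt_add (hγ : IsHyperbolic γ) (hδ : IsHyperbolic δ) {p q : ℝ}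
    (hpq : p < q) (hp : f p = h p) (hq : f q = h q) :
    translationLength (γ * δ) < translationLength γ + translationLength δ := by
  have hγ' : 0 < translationLength γ := hγ
  have hδ' : 0 < translationLength δ := hδ
  set a := translationLength γ
  set b := translationLength δ
  -- The final piece `[r, q]` of the overlap, at most as long as either translation, is saved twice
  -- on the path from `γ⁻¹ (f q)` to `δ (f q)` through `f r`.
  obtain ⟨r, hpr, hrq, hra, hrb⟩ : ∃ r, p ≤ r ∧ r < q ∧ q - r ≤ a ∧ q - r ≤ b := by
    refine ⟨max p (q - min a b), le_max_left _ _, max_lt hpq ?_, ?_, ?_⟩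
    · linarith [lt_min hγ' hδ']
    · linarith [le_max_right p (q - min a b), min_le_left a b]
    · linarith [le_max_right p (q - min a b), min_le_right a b]
  have hr := H.eq_of_le_of_le hT hp hq hpr hrq.le
  have h1 := translationLength_le (γ * δ) (f q)
  have h2 : dist (f q) ((γ * δ) (f q)) = dist (γ.symm (f q)) (δ (f q)) := by
    rw [← γ.isometry.dist_eq (γ.symm (f q)), γ.apply_symm_apply]
    rfl
  have h3 := dist_triangle (γ.symm (f q)) (f r) (δ (f q))
  rw [← h2, H.symm_left, hr, hq, H.map_right, ← hr, H.isometry_left.dist_eq, hr,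
    H.isometry_right.dist_eq, Real.dist_eq, Real.dist_eq, abs_of_nonpos (by linarith),
    abs_of_nonneg (by linarith)] at h3
  rw [hq] at h1
  linarith

/-- The base point is `h q`. The segments joining it to its preimage and to its image under `γ * δ`
overlap along `[h (p + a), h q]`, the image under `γ` of `[h p, h (q - a)]`. -/
theorem translationLength_mul_eq_sub_of_lt_of_lt {p q : ℝ} (hp : f p = h p) (hq : f q = h q)
    (ha : 0 < translationLength γ)
    (hap : translationLength γ < q - p) (hb : q - p < translationLength δ) :
    translationLength (γ * δ) = translationLength δ - translationLength γ := by
  set a := translationLength γ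
  set b := translationLength δ
  have hqa : f (q - a) = h (q - a) := H.eq_of_le_of_le hT hp hq (by linarith) (by linarith)
  have hpa : f (p + a) = h (p + a) := H.eq_of_le_of_le hT hp hq (by linarith) (by linarith)
  have hinv : δ.symm (γ.symm (h q)) = h (q - a + b) := by
    rw [← hq, H.symm_left, hqa, H.symm_right]
  have hγp : γ (h p) = h (p + a) := by rw [← hp, H.map_left, hpa]
  have hγq : γ (h (q - a)) = h q := by rw [← hqa, H.map_left, sub_add_cancel, hq]
  have h1 : Btw (h (q - a + b)) (h q) (h (p + a)) :=
    btw_of_isometry_anti H.isometry_right (by linarith) (by linarith)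
  have h2 : Btw (h q) (h (p + a)) (γ (h (q - b))) := by
    rw [← hγq, ← hγp, btw_map_iff]
    exact btw_of_isometry_anti H.isometry_right (by linarith) (by linarith)
  have h3 := (hT.btw_concat h1 h2 fun h => by linarith [H.isometry_right.injective h]).1
  rw [← H.map_right, ← hinv] at h3
  have h4 := (h3.map δ).map γ
  rw [δ.apply_symm_apply, γ.apply_symm_apply] at h4
  rw [hT.translationLength_of_btw (g := γ * δ) (x := h q) h4]
  change dist (h q) (γ (δ (h q))) = _
  rw [H.map_right, ← hγq, γ.isometry.dist_eq, H.isometry_right.dist_eq, Real.dist_eq,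
    abs_of_pos (by linarith)]
  ring

end OppositeParam

end Opposite

/-! ### Overlap of length exactly `l(γ)`: folding of the axis of `δ`. -/

section Opposite

variable {T : Type*} [MetricSpace T] {γ δ : T ≃ᵢ T} {f h : ℝ → T} (H : OppositeParam γ δ f h)
  (hT : IsRTree T)
include H

namespace OppositeParam

theorem map_left_of_coincidence {p q : ℝ} (hp : f p = h p) (hq : f q = h q)
    (hqp : q - p = translationLength γ) : γ (h p) = h q := by
  rw [← hp, H.map_left, ← hq, ← hqp, add_sub_cancel]

/-- The set records how far `γ` sends the part of the axis of `δ` before `p` onto the part after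
`q`, reversing the parameter. -/
theorem isClosed_fold (p q : ℝ) : IsClosed {t : ℝ | 0 ≤ t ∧ γ (h (p - t)) = h (q + t)} := by
  have := H.isometry_right.continuous
  have := γ.continuous
  exact isClosed_Ici.inter (isClosed_eq (by fun_prop) (by fun_prop))

include hT

theorem ordConnected_fold {p q : ℝ} :
    {t : ℝ | 0 ≤ t ∧ γ (h (p - t)) = h (q + t)}.OrdConnected := by
  refine ⟨fun r hr t ht s hs => ⟨hr.1.trans hs.1, ?_⟩⟩
  obtain ⟨hs1, hs2⟩ := hs
  refine hT.eq_of_btw (x := h (q + r)) (y := h (q + t)) ?_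
    (btw_of_isometry H.isometry_right (by linarith) (by linarith)) ?_
  · rw [← hr.2, ← ht.2, btw_map_iff]
    exact btw_of_isometry_anti H.isometry_right (by linarith) (by linarith)
  · rw [H.isometry_right.dist_eq, ← hr.2, γ.isometry.dist_eq, H.isometry_right.dist_eq,
      Real.dist_eq, Real.dist_eq, abs_of_nonneg (by linarith), abs_of_nonpos (by linarith)]
    ring

/-- When the overlap has length `l(γ)`, the axis of `δ` meets its translate by `γ` in a segment
starting at the end of the overlap. -/
theorem axis_inter_image {p q : ℝ} (ha : 0 < translationLength γ)
    (hJ : {t | f t = h t} = Set.Icc p q) (hqp : q - p = translationLength γ) :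
    axis δ ∩ γ '' axis δ =
      (fun t => h (q + t)) '' {t : ℝ | 0 ≤ t ∧ γ (h (p - t)) = h (q + t)} := by
  have hp : f p = h p := hJ.symm.subset ⟨le_rfl, by linarith⟩
  have hq : f q = h q := hJ.symm.subset ⟨by linarith, le_rfl⟩
  have hmem : ∀ r, f r ∈ axis δ → p ≤ r ∧ r ≤ q := fun r hr => hJ.subset (H.eq_of_mem hr)
  have hpq := H.map_left_of_coincidence hp hq hqp
  refine Set.Subset.antisymm ?_ ?_
  · rintro z ⟨hz, _, hz', rfl⟩
    obtain ⟨s', rfl⟩ := H.range_right.symm.subset hz'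
    obtain ⟨s, hs⟩ := H.range_right.symm.subset hz
    have h1 : s' ≤ p := by
      -- Otherwise convexity puts `f (min s' q + l(γ))` on the axis of `δ`, although its parameter
      -- exceeds `q`.
      by_contra! hlt
      have h2 : p < min s' q := lt_min hlt (by linarith)
      have h3 : f (min s' q) = h (min s' q) := hJ.symm.subset ⟨h2.le, min_le_right _ _⟩
      have h4 : Btw (h q) (γ (h (min s' q))) (γ (h s')) := by
        rw [← hpq, btw_map_iff]
        exact btw_of_isometry H.isometry_right h2.le (min_le_left _ _)
      have h5 := hT.axis_convex (H.mem_right q) hz h4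
      rw [← h3, H.map_left] at h5
      linarith [(hmem _ h5).2]
    have h2 : q ≤ s := by
      by_contra! hlt
      have h2 : max s p < q := max_lt hlt (by linarith)
      have h3 : f (max s p) = h (max s p) := hJ.symm.subset ⟨le_max_right _ _, h2.le⟩
      have h4 : Btw (h p) (γ.symm (h (max s p))) (h s') := by
        rw [← btw_map_iff γ, γ.apply_symm_apply, hpq, ← hs]
        exact btw_of_isometry_anti H.isometry_right (le_max_left _ _) h2.le
      have h5 := hT.axis_convex (H.mem_right p) hz' h4
      rw [← h3, H.symm_left] at h5
      linarith [(hmem _ h5).1]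
    have h3 := γ.isometry.dist_eq (h p) (h s')
    rw [hpq, ← hs, H.isometry_right.dist_eq, H.isometry_right.dist_eq, Real.dist_eq, Real.dist_eq,
      abs_of_nonpos (by linarith), abs_of_nonneg (by linarith)] at h3
    refine ⟨s - q, ⟨by linarith, ?_⟩, ?_⟩
    · rw [add_sub_cancel, hs]
      congr 2
      linarith
    · simp only [add_sub_cancel, hs]
  · rintro _ ⟨t, ⟨-, ht⟩, rfl⟩
    exact ⟨H.mem_right _, _, H.mem_right _, ht⟩

theorem segmentLength_axis_inter_image {p q : ℝ} (ha : 0 < translationLength γ)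
    (hJ : {t | f t = h t} = Set.Icc p q) (hqp : q - p = translationLength γ) :
    segmentLength (axis δ ∩ γ '' axis δ) =
      Metric.ediam {t : ℝ | 0 ≤ t ∧ γ (h (p - t)) = h (q + t)} := by
  rw [segmentLength, H.axis_inter_image hT ha hJ hqp]
  exact (H.isometry_right.comp (isometry_add_left q)).ediam_image _

omit hT in
theorem translationLength_mul_eq_zero_of_fold {p q t : ℝ} (ht : γ (h (p - t)) = h (q + t))
    (hb : q - p + 2 * t = translationLength δ) : translationLength (γ * δ) = 0 := by
  refine translationLength_eq_zero_of_fixed (x := h (q + t)) ?_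
  change γ (δ _) = _
  rw [H.map_right, ← hb, ← ht]
  ring_nf

/-- The base point is the end `h (q + m)` of the fold. Maximality of `m` prevents the segments to
its preimage and image from sharing anything else. -/
theorem translationLength_mul_of_fold {p q m : ℝ} (ha : 0 < translationLength γ)
    (hJ : {t | f t = h t} = Set.Icc p q) (hqp : q - p = translationLength γ) (hm : 0 ≤ m)
    (hE : {t : ℝ | 0 ≤ t ∧ γ (h (p - t)) = h (q + t)} = Set.Icc 0 m)
    (hb : q - p + 2 * m < translationLength δ) :
    translationLength (γ * δ) = translationLength δ - (q - p) - 2 * m := by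
  set b := translationLength δ
  have hmE : γ (h (p - m)) = h (q + m) := (hE.symm.subset ⟨hm, le_rfl⟩).2
  have hinv : δ.symm (γ.symm (h (q + m))) = h (p - m + b) := by
    rw [← hmE, γ.symm_apply_apply, H.symm_right]
  have h3 : Btw (h (p - m + b)) (h (q + m)) (γ (δ (h (q + m)))) := by
    refine hT.btw_of_inter fun z h1 h2 => ?_
    have hz := hT.axis_convex (H.mem_right _) (H.mem_right _) h1
    rw [H.map_right, ← hmE] at h2
    obtain ⟨w, rfl⟩ := γ.surjective z
    rw [btw_map_iff] at h2
    have hw := hT.axis_convex (H.mem_right _) (H.mem_right _) h2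
    obtain ⟨t, ht, hzt⟩ := (H.axis_inter_image hT ha hJ hqp).subset ⟨hz, w, hw, rfl⟩
    have htm := (hE.subset ht).2
    simp only at hzt
    rw [← hzt] at h1 ⊢
    unfold Btw at h1
    simp only [H.isometry_right.dist_eq, Real.dist_eq] at h1
    rw [abs_of_nonneg (by linarith), abs_of_nonpos (by linarith),
      abs_of_nonneg (by linarith)] at h1
    congr 1
    linarith
  rw [← hinv] at h3
  have h4 := (h3.map δ).map γ
  rw [δ.apply_symm_apply, γ.apply_symm_apply] at h4
  rw [hT.translationLength_of_btw (g := γ * δ) (x := h (q + m)) h4]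
  change dist (h (q + m)) (γ (δ (h (q + m)))) = _
  rw [H.map_right, ← hmE, γ.isometry.dist_eq, H.isometry_right.dist_eq, Real.dist_eq,
    abs_of_pos (by linarith)]
  ring

end OppositeParam

end Opposite

/-! ### Opposite directions in terms of `segmentLength`. -/

section Opposite

variable {T : Type*} [MetricSpace T] (hT : IsRTree T) {γ δ : T ≃ᵢ T} (hγ : IsHyperbolic γ)
  (hδ : IsHyperbolic δ)
include hT hγ hδ

theorem IsRTree.translationLength_mul_of_ediam_lt (hnt : (axis γ ∩ axis δ).Nontrivial)
    (hdir : OppositeDirectionOn γ δ (axis γ ∩ axis δ))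
    (hD : segmentLength (axis γ ∩ axis δ) <
      ENNReal.ofReal (min (translationLength γ) (translationLength δ))) :
    translationLength (γ * δ) = translationLength γ + translationLength δ -
      2 * (segmentLength (axis γ ∩ axis δ)).toReal := by
  obtain ⟨f, h, H⟩ := hT.exists_oppositeParam hγ hδ hnt hdir
  have hne : {t | f t = h t}.Nonempty := by
    have := hnt.nonempty
    rwa [H.inter_eq_image, Set.image_nonempty] at this
  rw [H.segmentLength_inter] at hD ⊢
  obtain ⟨p, q, hpq, hJ, hd⟩ := exists_eq_Icc_of_ediam_ne_top hne H.isClosed_coincidence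
    (H.ordConnected_coincidence hT) hD.ne_top
  rw [hd, ENNReal.ofReal_lt_ofReal_iff (lt_min hγ hδ), lt_min_iff] at hD
  rw [hd, ENNReal.toReal_ofReal (by linarith)]
  exact H.translationLength_mul_of_lt hT hpq hJ hD.1 hD.2

theorem IsRTree.translationLength_mul_lt_add (hnt : (axis γ ∩ axis δ).Nontrivial)
    (hdir : OppositeDirectionOn γ δ (axis γ ∩ axis δ)) :
    translationLength (γ * δ) < translationLength γ + translationLength δ := by
  obtain ⟨f, h, H⟩ := hT.exists_oppositeParam hγ hδ hnt hdir
  rw [H.inter_eq_image] at hnt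
  obtain ⟨_, ⟨p, hp, rfl⟩, _, ⟨q, hq, rfl⟩, hpq⟩ := hnt
  rcases lt_or_gt_of_ne fun h : p = q => hpq (congrArg f h) with hlt | hlt
  · exact H.translationLength_mul_lt_add hT hγ hδ hlt hp hq
  · exact H.translationLength_mul_lt_add hT hγ hδ hlt hq hp

theorem IsRTree.translationLength_mul_of_lt_ediam (hnt : (axis γ ∩ axis δ).Nontrivial)
    (hdir : OppositeDirectionOn γ δ (axis γ ∩ axis δ))
    (hab : translationLength γ < translationLength δ)
    (hD : ENNReal.ofReal (translationLength γ) < segmentLength (axis γ ∩ axis δ)) :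
    translationLength (γ * δ) = translationLength δ - translationLength γ := by
  obtain ⟨f, h, H⟩ := hT.exists_oppositeParam hγ hδ hnt hdir
  rw [H.segmentLength_inter] at hD
  obtain ⟨p, hp, q, hq, hpq, hlt⟩ := exists_lt_sub_of_lt_ediam hD
  -- The overlap may exceed `l(δ)` or be infinite; a subsegment of length `r` strictly between
  -- `l(γ)` and `l(δ)` suffices.
  obtain ⟨r, hr1, hr2⟩ := exists_between (lt_min hlt hab)
  have hr3 := min_le_left (q - p) (translationLength δ)
  have hr4 := min_le_right (q - p) (translationLength δ)
  have hγ' : 0 < translationLength γ := hγ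
  have hr := H.eq_of_le_of_le hT hp hq (s := p + r) (by linarith) (by linarith)
  exact H.translationLength_mul_eq_sub_of_lt_of_lt hT hp hr hγ (by linarith) (by linarith)

theorem IsRTree.translationLength_mul_eq_zero (hnt : (axis γ ∩ axis δ).Nontrivial)
    (hdir : OppositeDirectionOn γ δ (axis γ ∩ axis δ))
    (hab : translationLength γ = translationLength δ)
    (hD : ENNReal.ofReal (translationLength γ) ≤ segmentLength (axis γ ∩ axis δ)) :
    translationLength (γ * δ) = 0 := by
  obtain ⟨f, h, H⟩ := hT.exists_oppositeParam hγ hδ hnt hdir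
  have hγ' : 0 < translationLength γ := hγ
  rw [H.segmentLength_inter] at hD
  obtain ⟨p, hp, q, hq, hpq⟩ : ∃ p, f p = h p ∧ ∃ q, f q = h q ∧ translationLength γ ≤ q - p := by
    rcases hD.lt_or_eq with hlt | heq
    · obtain ⟨p, hp, q, hq, -, hlt⟩ := exists_lt_sub_of_lt_ediam hlt
      exact ⟨p, hp, q, hq, hlt.le⟩
    · have hne : {t | f t = h t}.Nonempty := by
        have := hnt.nonempty
        rwa [H.inter_eq_image, Set.image_nonempty] at this
      obtain ⟨p, q, hpq, hJ, hd⟩ := exists_eq_Icc_of_ediam_ne_top hne H.isClosed_coincidence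
        (H.ordConnected_coincidence hT) (heq ▸ ENNReal.ofReal_ne_top)
      rw [hd, ENNReal.ofReal_eq_ofReal_iff hγ'.le (by linarith)] at heq
      exact ⟨p, hJ.symm.subset ⟨le_rfl, hpq⟩, q, hJ.symm.subset ⟨hpq, le_rfl⟩, heq.le⟩
  exact H.translationLength_mul_eq_zero hab hp
    (H.eq_of_le_of_le hT hp hq (by linarith) (by linarith))

theorem IsRTree.translationLength_mul_of_ediam_eq (hnt : (axis γ ∩ axis δ).Nontrivial)
    (hdir : OppositeDirectionOn γ δ (axis γ ∩ axis δ))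
    (hab : translationLength γ < translationLength δ)
    (hD : ENNReal.ofReal (translationLength γ) = segmentLength (axis γ ∩ axis δ)) :
    (ENNReal.ofReal (translationLength δ) ≤
        segmentLength (axis γ ∩ axis δ) + 2 * segmentLength (axis δ ∩ γ '' axis δ) →
      translationLength (γ * δ) = 0) ∧
    (segmentLength (axis γ ∩ axis δ) + 2 * segmentLength (axis δ ∩ γ '' axis δ) <
        ENNReal.ofReal (translationLength δ) →
      translationLength (γ * δ) = translationLength δ -
        (segmentLength (axis γ ∩ axis δ)).toReal -
        2 * (segmentLength (axis δ ∩ γ '' axis δ)).toReal) := by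
  obtain ⟨f, h, H⟩ := hT.exists_oppositeParam hγ hδ hnt hdir
  have hγ' : 0 < translationLength γ := hγ
  have hδ' : 0 < translationLength δ := hδ
  have hne : {t | f t = h t}.Nonempty := by
    have := hnt.nonempty
    rwa [H.inter_eq_image, Set.image_nonempty] at this
  rw [← hD]
  rw [H.segmentLength_inter] at hD
  obtain ⟨p, q, hpq, hJ, hd⟩ := exists_eq_Icc_of_ediam_ne_top hne H.isClosed_coincidence
    (H.ordConnected_coincidence hT) (hD ▸ ENNReal.ofReal_ne_top)
  rw [hd, ENNReal.ofReal_eq_ofReal_iff hγ'.le (by linarith)] at hD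
  rw [H.segmentLength_axis_inter_image hT hγ hJ hD.symm]
  set E := {t : ℝ | 0 ≤ t ∧ γ (h (p - t)) = h (q + t)}
  have h0E : (0 : ℝ) ∈ E := by
    refine ⟨le_rfl, ?_⟩
    rw [sub_zero, add_zero]
    exact H.map_left_of_coincidence (hJ.symm.subset ⟨le_rfl, hpq⟩) (hJ.symm.subset ⟨hpq, le_rfl⟩)
      hD.symm
  have hEcl : IsClosed E := H.isClosed_fold p q
  have hEoc : E.OrdConnected := H.ordConnected_fold hT
  -- This parameter solves `q - p + 2 * t = l(δ)`: `δ` moves `h (q + t)` to `h (p - t)`, and the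
  -- fold moves it back.
  have hfix : (translationLength δ - translationLength γ) / 2 ∈ E →
      translationLength (γ * δ) = 0 := fun ht =>
    H.translationLength_mul_eq_zero_of_fold ht.2 (by linarith)
  by_cases hfin : Metric.ediam E = ⊤
  · refine ⟨fun _ => hfix ?_, fun hlt => ?_⟩
    · obtain ⟨x, hx, y, hy, -, hlt⟩ := exists_lt_sub_of_lt_ediam
        (J := E) (a := (translationLength δ - translationLength γ) / 2)
        (hfin ▸ ENNReal.ofReal_lt_top)
      exact hEoc.out h0E hy ⟨by linarith, by linarith [hx.1]⟩
    · rw [hfin, ENNReal.mul_top two_ne_zero, add_top] at hlt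
      exact absurd hlt not_top_lt
  · obtain ⟨m₀, m, hm, hE, hm'⟩ := exists_eq_Icc_of_ediam_ne_top ⟨0, h0E⟩ hEcl hEoc hfin
    obtain rfl : m₀ = 0 := le_antisymm (hE.subset h0E).1 (hE.symm.subset ⟨le_rfl, hm⟩).1
    have hsum : ENNReal.ofReal (translationLength γ) + 2 * ENNReal.ofReal m =
        ENNReal.ofReal (translationLength γ + 2 * m) := by
      rw [ENNReal.ofReal_add hγ'.le (by positivity), ENNReal.ofReal_mul zero_le_two]
      simp
    rw [hm', sub_zero, hsum]
    refine ⟨fun hle => hfix ?_, fun hlt => ?_⟩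
    · rw [ENNReal.ofReal_le_ofReal_iff (by positivity)] at hle
      exact hE.symm.subset ⟨by linarith, by linarith⟩
    · rw [ENNReal.ofReal_lt_ofReal_iff hδ'] at hlt
      rw [H.translationLength_mul_of_fold hT hγ hJ hD.symm hm hE (by linarith), hD,
        ENNReal.toReal_ofReal hm, ENNReal.toReal_ofReal (by linarith)]

end Opposite

end RTree

/-! ### Assembly of the cases. -/

theorem propositionA1 {T : Type*} [MetricSpace T] (hT : RTree.IsRTree T) (γ δ : T ≃ᵢ T)
    (hγ : RTree.IsHyperbolic γ) (hδ : RTree.IsHyperbolic δ) :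
    -- disjoint axes
    (RTree.axis γ ∩ RTree.axis δ = ∅ →
      (∃ (S : Set T) (p q : T), RTree.IsConnectingArc S (RTree.axis γ) (RTree.axis δ) p q) ∧
      ∀ (S : Set T) (p q : T), RTree.IsConnectingArc S (RTree.axis γ) (RTree.axis δ) p q →
        RTree.IsHyperbolic (γ * δ) ∧
        S ⊆ RTree.axis (γ * δ) ∧
        RTree.TranslatesTowards (γ * δ) q p ∧
        RTree.translationLength (γ * δ) =
          RTree.translationLength γ + RTree.translationLength δ + 2 * dist p q) ∧
    -- intersecting axes
    ((RTree.axis γ ∩ RTree.axis δ).Nonempty →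
      ∀ D : ENNReal, D = RTree.segmentLength (RTree.axis γ ∩ RTree.axis δ) →
        -- same direction, or intersection reduced to a point
        ((0 < D ∧ RTree.SameDirectionOn γ δ (RTree.axis γ ∩ RTree.axis δ)) ∨ D = 0 →
          RTree.translationLength (γ * δ) =
            RTree.translationLength γ + RTree.translationLength δ) ∧
        -- opposite directions
        (0 < D → RTree.OppositeDirectionOn γ δ (RTree.axis γ ∩ RTree.axis δ) →
          ∀ D' : ENNReal,
            (RTree.translationLength γ < RTree.translationLength δ →
              D' = RTree.segmentLength (RTree.axis δ ∩ γ '' RTree.axis δ)) →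
            (RTree.translationLength δ < RTree.translationLength γ →
              D' = RTree.segmentLength (RTree.axis γ ∩ δ '' RTree.axis γ)) →
            (D < ENNReal.ofReal
                (min (RTree.translationLength γ) (RTree.translationLength δ)) →
              RTree.translationLength (γ * δ) =
                RTree.translationLength γ + RTree.translationLength δ - 2 * D.toReal) ∧
            ((ENNReal.ofReal
                  (min (RTree.translationLength γ) (RTree.translationLength δ)) < D ∧
                D < ENNReal.ofReal
                  (max (RTree.translationLength γ) (RTree.translationLength δ))) ∨
              ENNReal.ofReal
                (max (RTree.translationLength γ) (RTree.translationLength δ)) ≤ D →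
              RTree.translationLength (γ * δ) =
                |RTree.translationLength γ - RTree.translationLength δ|) ∧
            (ENNReal.ofReal
                (min (RTree.translationLength γ) (RTree.translationLength δ)) = D →
              D < ENNReal.ofReal
                (max (RTree.translationLength γ) (RTree.translationLength δ)) →
              ENNReal.ofReal
                (max (RTree.translationLength γ) (RTree.translationLength δ)) ≤ D + 2 * D' →
              RTree.translationLength (γ * δ) = 0) ∧
            (ENNReal.ofReal
                (min (RTree.translationLength γ) (RTree.translationLength δ)) = D →
              D + 2 * D' < ENNReal.ofReal
                (max (RTree.translationLength γ) (RTree.translationLength δ)) →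
              RTree.translationLength (γ * δ) =
                max (RTree.translationLength γ) (RTree.translationLength δ)
                  - D.toReal - 2 * D'.toReal) ∧
            RTree.translationLength (γ * δ) <
              RTree.translationLength γ + RTree.translationLength δ)) := by
  refine ⟨fun hdisj => ⟨hT.exists_isConnectingArc hγ hδ, fun S p q hS =>
    hT.isConnectingArc_axis hγ hδ hdisj hS⟩, fun hne D hD => ⟨?_, ?_⟩⟩
  · have hnt : 0 < D → (RTree.axis γ ∩ RTree.axis δ).Nontrivial := fun h => by
      rw [← Set.not_subsingleton_iff, ← Metric.ediam_eq_zero_iff]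
      exact fun h0 => h.ne' (hD.trans h0)
    rintro (⟨hpos, hdir⟩ | h0)
    · exact hT.translationLength_mul_of_sameDirection hγ hδ (hnt hpos) hdir
    · exact hT.translationLength_mul_of_inter_subsingleton hγ hδ hne
        (Metric.ediam_eq_zero_iff.1 (hD.symm.trans h0))
  · intro hpos hdir D' hD'₁ hD'₂
    have hnt : (RTree.axis γ ∩ RTree.axis δ).Nontrivial := by
      rw [← Set.not_subsingleton_iff, ← Metric.ediam_eq_zero_iff]
      exact fun h0 => hpos.ne' (hD.trans h0)
    have hnt' : (RTree.axis δ ∩ RTree.axis γ).Nontrivial := by rwa [Set.inter_comm]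
    have hdir' : RTree.OppositeDirectionOn δ γ (RTree.axis δ ∩ RTree.axis γ) :=
      fun x hx y hy => (hdir y hy.symm x hx.symm).symm
    have hDs : D = RTree.segmentLength (RTree.axis δ ∩ RTree.axis γ) := by rwa [Set.inter_comm]
    refine ⟨fun hlt => ?_, fun h => ?_, fun heq hlt hle => ?_, fun heq hlt => ?_,
      hT.translationLength_mul_lt_add hγ hδ hnt hdir⟩
    · subst hD
      exact hT.translationLength_mul_of_ediam_lt hγ hδ hnt hdir hlt
    · rcases lt_trichotomy (RTree.translationLength γ) (RTree.translationLength δ)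
        with hab | hab | hab
      · have ha : ENNReal.ofReal (RTree.translationLength γ) < D := by
          rw [min_eq_left hab.le, max_eq_right hab.le] at h
          rcases h with h | h
          · exact h.1
          · exact ((ENNReal.ofReal_lt_ofReal_iff hδ).2 hab).trans_le h
        rw [hT.translationLength_mul_of_lt_ediam hγ hδ hnt hdir hab (hD ▸ ha),
          abs_of_neg (by linarith)]
        ring
      · have ha : ENNReal.ofReal (RTree.translationLength γ) ≤ D := by
          rw [← hab, min_self, max_self] at h
          rcases h with h | h
          · exact h.1.le
          · exact h
        rw [hT.translationLength_mul_eq_zero hγ hδ hnt hdir hab (hD ▸ ha), hab, sub_self, abs_zero]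
      · have ha : ENNReal.ofReal (RTree.translationLength δ) < D := by
          rw [min_eq_right hab.le, max_eq_left hab.le] at h
          rcases h with h | h
          · exact h.1
          · exact ((ENNReal.ofReal_lt_ofReal_iff hγ).2 hab).trans_le h
        rw [RTree.translationLength_mul_comm,
          hT.translationLength_mul_of_lt_ediam hδ hγ hnt' hdir' hab (hDs ▸ ha),
          abs_of_pos (by linarith)]
    · rcases lt_trichotomy (RTree.translationLength γ) (RTree.translationLength δ)
        with hab | hab | hab
      · rw [max_eq_right hab.le, hD'₁ hab, hD] at hle
        rw [min_eq_left hab.le, hD] at heq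
        exact (hT.translationLength_mul_of_ediam_eq hγ hδ hnt hdir hab heq).1 hle
      · rw [← heq, hab, min_self, max_self] at hlt
        exact absurd hlt (lt_irrefl _)
      · rw [max_eq_left hab.le, hD'₂ hab, hDs] at hle
        rw [min_eq_right hab.le, hDs] at heq
        rw [RTree.translationLength_mul_comm]
        exact (hT.translationLength_mul_of_ediam_eq hδ hγ hnt' hdir' hab heq).1 hle
    · rcases lt_trichotomy (RTree.translationLength γ) (RTree.translationLength δ)
        with hab | hab | hab
      · rw [max_eq_right hab.le, hD'₁ hab, hD] at hlt ⊢
        rw [min_eq_left hab.le, hD] at heq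
        exact (hT.translationLength_mul_of_ediam_eq hγ hδ hnt hdir hab heq).2 hlt
      · rw [← heq, hab, min_self, max_self] at hlt
        exact absurd hlt (not_lt.2 le_self_add)
      · rw [max_eq_left hab.le, hD'₂ hab, hDs] at hlt ⊢
        rw [min_eq_right hab.le, hDs] at heq
        rw [RTree.translationLength_mul_comm]
        exact (hT.translationLength_mul_of_ediam_eq hδ hγ hnt' hdir' hab heq).2 hlt
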